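/- Let $G$ be a finite connected graph (loops and parallel edges allowed). For edge lengths $\ell : E(G)\to\mathbb{R}_{>0}$ let $\Gamma=(G,\ell)$ be the metric graph obtained by gluing the segments $[0,\ell(e)]$ along the vertices of $G$. Write $\operatorname{Div}(\Gamma)$ for the free abelian group on the points of $\Gamma$, $\operatorname{Pic}(\Gamma)$ for its quotient by the divisors of continuous piecewise linear functions with integer slopes (the coefficient of such a divisor at a point is minus the sum of the outgoing slopes), $[D]$ for the class of a divisor $D$, and $\operatorname{Jac}(\Gamma)=\operatorname{Pic}^0(\Gamma)$ for the group of classes of degree $0$. Two classes $[D],[E]$ of effective divisors of the same degree are *torsion equivalent* if $n[D-E]=0$ for some integer $n\ge 1$. $\Gamma$ satisfies the *degree-$d$ Manin–Mumford condition* if for every effective divisor $D$ of degree $d$ the image of $\Gamma^d\to\operatorname{Jac}(\Gamma)$, $(x_1,\dots,x_d)\mapsto[x_1+\cdots+x_d-D]$, contains only finitely many torsion points of $\operatorname{Jac}(\Gamma)$. For edges $e_1,\dots,e_d$ let $\operatorname{Eff}(e_1,\dots,e_d)=\{[x_1+\cdots+x_d] : x_i\in e_i\}$, where the edges are closed. 1.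 If $G$ has a cycle with exactly $d$ edges, then for every choice of edge lengths $\ell$ the metric graph $(G,\ell)$ does not satisfy the degree-$d$ Manin–Mumford condition. 2. More precisely, let $C$ be a cycle of $G$ with distinct vertices $v_1,\dots,v_d$ and distinct edges $e_1,\dots,e_d$, where $e_i$ joins $v_i$ to $v_{i+1}$ (indices modulo $d$), let $\ell$ be any edge lengths, and let $x_i$ be the midpoint of $e_i$. Then the classes $[v_1+\cdots+v_d]$ and $[x_1+\cdots+x_d]$ are distinct, torsion equivalent, and both lie in the cell $\operatorname{Eff}(e_1,\dots,e_d)$. 3. If $G$ has girth $\gamma$ (the minimal number of edges of a cycle, $\gamma=\infty$ if there is none), then for every choice of edge lengths $\ell$ and every integer $d\ge\gamma$ the metric graph $(G,\ell)$ does not satisfy the degree-$d$ Manin–Mumford condition. -/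

import Mathlib

open Set

noncomputable section

/-- An oriented graph with vertex set `V` and edge set `E`; loops and parallel edges are allowed.
Finiteness of `V` and `E` is imposed where it is used. -/
structure OrientedGraph (V E : Type*) where
  head : E → V
  tail : E → V

namespace OrientedGraph

variable {V E : Type*} (G : OrientedGraph V E)

/-- The graph is nonempty and any two vertices are joined by a path of edges, traversed in either
direction. -/
def Connected : Prop :=
  Nonempty V ∧ ∀ u v : V, Relation.EqvGen (fun a b => ∃ e, G.tail e = a ∧ G.head e = b) u v

/-- A cycle with exactly `d` edges, as a subgraph together with a cyclic enumeration of its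
distinct vertices `v₁, …, v_d` and of its distinct edges `e₁, …, e_d`: the edge `e_i` lies between
`v_i` and `v_{i+1}`, with indices modulo `d` (`finRotate d` is the cyclic successor on `Fin d`).
A loop is a cycle with one edge, two parallel edges form a cycle with two edges. -/
structure Cycle (d : ℕ) where
  pos : 0 < d
  vertex : Fin d → V
  edge : Fin d → E
  vertex_injective : Function.Injective vertex
  edge_injective : Function.Injective edge
  endpoints : ∀ i : Fin d,
    (G.tail (edge i) = vertex i ∧ G.head (edge i) = vertex (finRotate d i)) ∨
    (G.head (edge i) = vertex i ∧ G.tail (edge i) = vertex (finRotate d i))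

/-- The girth: the minimal number of edges of a cycle, and `∞` if there is no cycle. -/
def girth : ℕ∞ := sInf {n : ℕ∞ | ∃ d : ℕ, n = d ∧ Nonempty (G.Cycle d)}

/-! ### The metric graph `(G, ℓ)`

The lengths are `ℓ : E → ℝ_{>0}`, and `ℝ_{>0}` is written as `Set.Ioi (0 : ℝ)`. -/

variable (ℓ : E → Ioi (0 : ℝ))

/-- The points of the metric graph `(G, ℓ)`: the closed segments `[0, ℓ(e)]` are glued at their
endpoints, so a point is a vertex or a point in the interior of exactly one edge. -/
inductive Point (_G : OrientedGraph V E) (ℓ : E → Ioi (0 : ℝ))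
  | vertex (v : V) : Point _G ℓ
  | interior (e : E) (t : ℝ) (pos : 0 < t) (lt : t < ℓ e) : Point _G ℓ

open Classical in
/-- The length-preserving parametrization of the edge `e` by `[0, ℓ(e)]`, from the tail to the head
(extended to all of `ℝ` by constants). -/
def edgePoint (e : E) (t : ℝ) : G.Point ℓ :=
  if h₀ : t ≤ 0 then .vertex (G.tail e)
  else if h₁ : (ℓ e : ℝ) ≤ t then .vertex (G.head e)
  else .interior e t (not_le.mp h₀) (not_le.mp h₁)

/-- The topology of the metric graph is the quotient topology of the gluing: the finest one for
which all the parametrizations of the closed edges are continuous. -/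
instance : TopologicalSpace (G.Point ℓ) :=
  ⨆ e : E, TopologicalSpace.coinduced (fun t : Icc (0 : ℝ) (ℓ e) => G.edgePoint ℓ e t) inferInstance

/-- The midpoint of an edge. -/
def midpoint (e : E) : G.Point ℓ := G.edgePoint ℓ e ((ℓ e : ℝ) / 2)

/-! ### Piecewise `ℤ`-linear functions and their divisors -/

/-- Piecewise `ℤ`-linear functions: continuous, and for each edge there is a finite set of break
points such that the function is affine with an integer slope on every closed segment of the edge
without a break point in its interior. -/
def IsPLInt (f : G.Point ℓ → ℝ) : Prop :=
  Continuous f ∧ ∀ e : E, ∃ S : Finset ℝ, ∀ a b : ℝ, 0 ≤ a → a < b → b ≤ ℓ e →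
    (∀ s ∈ S, s ∉ Ioo a b) →
    ∃ m : ℤ, ∀ t ∈ Icc a b,
      f (G.edgePoint ℓ e t) = f (G.edgePoint ℓ e a) + m * (t - a)

/-- The slope of `f` along the edge `e` just after the parameter `t`, as the parameter grows. -/
def slopeRight (f : G.Point ℓ → ℝ) (e : E) (t : ℝ) : ℝ :=
  derivWithin (fun s => f (G.edgePoint ℓ e s)) (Ici t) t

/-- The slope of `f` along the edge `e` just before the parameter `t`, as the parameter grows. -/
def slopeLeft (f : G.Point ℓ → ℝ) (e : E) (t : ℝ) : ℝ :=
  derivWithin (fun s => f (G.edgePoint ℓ e s)) (Iic t) t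

open Classical in
/-- The sum of the slopes of `f` at a point, over all the directions leaving that point. A loop at a
vertex contributes two directions. -/
def outgoingSlope [Fintype E] (f : G.Point ℓ → ℝ) : G.Point ℓ → ℝ
  | .vertex v => (∑ e with G.tail e = v, G.slopeRight ℓ f e 0) +
      ∑ e with G.head e = v, -G.slopeLeft ℓ f e (ℓ e)
  | .interior e t _ _ => G.slopeRight ℓ f e t + -G.slopeLeft ℓ f e t

/-! Helper facts: sums and opposites of piecewise `ℤ`-linear functions. -/

section helpers

variable {G ℓ}

lemma exists_gap (S : Finset ℝ) (t : ℝ) :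
    ∃ ε > 0, ∀ s ∈ S, s ∉ Ioo t (t + ε) ∧ s ∉ Ioo (t - ε) t := by
  have hc : IsClosed ((↑(S.erase t) : Set ℝ)) := (S.erase t).finite_toSet.isClosed
  have hm : ((↑(S.erase t) : Set ℝ))ᶜ ∈ nhds t :=
    hc.isOpen_compl.mem_nhds (by simp)
  obtain ⟨ε, hε, hb⟩ := Metric.mem_nhds_iff.mp hm
  refine ⟨ε, hε, fun s hs => ?_⟩
  have key : s ≠ t → ε ≤ |s - t| := by
    intro hne
    by_contra hlt
    have : s ∈ Metric.ball t ε := by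
      rw [Metric.mem_ball, Real.dist_eq]; exact not_le.mp hlt
    exact hb this (by simp [hs, hne])
  constructor
  · rintro ⟨h1, h2⟩
    have := key h1.ne'
    rw [abs_of_pos (by linarith)] at this
    linarith
  · rintro ⟨h1, h2⟩
    have := key h2.ne
    rw [abs_of_neg (by linarith)] at this
    linarith

lemma IsPLInt.differentiableRight {f : G.Point ℓ → ℝ} (hf : G.IsPLInt ℓ f) (e : E) {t : ℝ}
    (h0 : 0 ≤ t) (h1 : t < ℓ e) :
    DifferentiableWithinAt ℝ (fun s => f (G.edgePoint ℓ e s)) (Ici t) t := by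
  obtain ⟨S, hS⟩ := hf.2 e
  obtain ⟨ε, hε, hgap⟩ := exists_gap S t
  have hb : t < min (t + ε) (ℓ e) := lt_min (by linarith) h1
  obtain ⟨m, hm⟩ := hS t (min (t + ε) (ℓ e)) h0 hb (min_le_right _ _)
    (fun s hs h => (hgap s hs).1 ⟨h.1, h.2.trans_le (min_le_left _ _)⟩)
  have hd : DifferentiableWithinAt ℝ (fun s => f (G.edgePoint ℓ e t) + (m : ℝ) * (s - t))
      (Icc t (min (t + ε) (ℓ e))) t := by fun_prop
  have hd' := DifferentiableWithinAt.congr hd (fun s hs => hm s hs)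
    (hm _ (left_mem_Icc.mpr hb.le))
  exact DifferentiableWithinAt.mono_of_mem_nhdsWithin hd' (Icc_mem_nhdsGE hb)

lemma IsPLInt.differentiableLeft {f : G.Point ℓ → ℝ} (hf : G.IsPLInt ℓ f) (e : E) {t : ℝ}
    (h0 : 0 < t) (h1 : t ≤ ℓ e) :
    DifferentiableWithinAt ℝ (fun s => f (G.edgePoint ℓ e s)) (Iic t) t := by
  obtain ⟨S, hS⟩ := hf.2 e
  obtain ⟨ε, hε, hgap⟩ := exists_gap S t
  have hb : max (t - ε) 0 < t := max_lt (by linarith) h0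
  obtain ⟨m, hm⟩ := hS (max (t - ε) 0) t (le_max_right _ _) hb h1
    (fun s hs h => (hgap s hs).2 ⟨(le_max_left _ _).trans_lt h.1, h.2⟩)
  have hd : DifferentiableWithinAt ℝ
      (fun s => f (G.edgePoint ℓ e (max (t - ε) 0)) + (m : ℝ) * (s - max (t - ε) 0))
      (Icc (max (t - ε) 0) t) t := by fun_prop
  have hd' := DifferentiableWithinAt.congr hd (fun s hs => hm s hs)
    (hm _ (right_mem_Icc.mpr hb.le))
  exact DifferentiableWithinAt.mono_of_mem_nhdsWithin hd' (Icc_mem_nhdsLE hb)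

lemma IsPLInt.zero : G.IsPLInt ℓ (fun _ => 0) :=
  ⟨continuous_const, fun _ => ⟨∅, fun _ _ _ _ _ _ => ⟨0, fun _ _ => by simp⟩⟩⟩

lemma IsPLInt.neg {f : G.Point ℓ → ℝ} (hf : G.IsPLInt ℓ f) : G.IsPLInt ℓ (fun x => -f x) := by
  refine ⟨hf.1.neg, fun e => ?_⟩
  obtain ⟨S, hS⟩ := hf.2 e
  refine ⟨S, fun a b h0 hab hb hs => ?_⟩
  obtain ⟨m, hm⟩ := hS a b h0 hab hb hs
  refine ⟨-m, fun t ht => ?_⟩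
  simp only [hm t ht]; push_cast; ring

lemma IsPLInt.add {f g : G.Point ℓ → ℝ} (hf : G.IsPLInt ℓ f) (hg : G.IsPLInt ℓ g) :
    G.IsPLInt ℓ (fun x => f x + g x) := by
  classical
  refine ⟨hf.1.add hg.1, fun e => ?_⟩
  obtain ⟨S, hS⟩ := hf.2 e
  obtain ⟨T, hT⟩ := hg.2 e
  refine ⟨S ∪ T, fun a b h0 hab hb hs => ?_⟩
  obtain ⟨m, hm⟩ := hS a b h0 hab hb (fun s h => hs s (Finset.mem_union_left _ h))
  obtain ⟨n, hn⟩ := hT a b h0 hab hb (fun s h => hs s (Finset.mem_union_right _ h))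
  refine ⟨m + n, fun t ht => ?_⟩
  simp only [hm t ht, hn t ht]; push_cast; ring

lemma slopeRight_add {f g : G.Point ℓ → ℝ} (hf : G.IsPLInt ℓ f) (hg : G.IsPLInt ℓ g) (e : E)
    {t : ℝ} (h0 : 0 ≤ t) (h1 : t < ℓ e) :
    G.slopeRight ℓ (fun x => f x + g x) e t = G.slopeRight ℓ f e t + G.slopeRight ℓ g e t :=
  derivWithin_fun_add (hf.differentiableRight e h0 h1) (hg.differentiableRight e h0 h1)

lemma slopeLeft_add {f g : G.Point ℓ → ℝ} (hf : G.IsPLInt ℓ f) (hg : G.IsPLInt ℓ g) (e : E)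
    {t : ℝ} (h0 : 0 < t) (h1 : t ≤ ℓ e) :
    G.slopeLeft ℓ (fun x => f x + g x) e t = G.slopeLeft ℓ f e t + G.slopeLeft ℓ g e t :=
  derivWithin_fun_add (hf.differentiableLeft e h0 h1) (hg.differentiableLeft e h0 h1)

lemma outgoingSlope_zero [Fintype E] (x : G.Point ℓ) :
    G.outgoingSlope ℓ (fun _ => 0) x = 0 := by
  cases x <;> simp [outgoingSlope, slopeRight, slopeLeft]

lemma outgoingSlope_neg [Fintype E] (f : G.Point ℓ → ℝ) (x : G.Point ℓ) :
    G.outgoingSlope ℓ (fun y => -f y) x = -G.outgoingSlope ℓ f x := by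
  cases x <;> simp [outgoingSlope, slopeRight, slopeLeft, derivWithin.fun_neg, add_comm]

lemma outgoingSlope_add [Fintype E] {f g : G.Point ℓ → ℝ} (hf : G.IsPLInt ℓ f)
    (hg : G.IsPLInt ℓ g) (x : G.Point ℓ) :
    G.outgoingSlope ℓ (fun y => f y + g y) x =
      G.outgoingSlope ℓ f x + G.outgoingSlope ℓ g x := by
  cases x with
  | vertex v =>
    have hr := fun e => slopeRight_add hf hg e le_rfl (ℓ e).2
    have hl := fun e => slopeLeft_add hf hg e (ℓ e).2 le_rfl
    simp only [outgoingSlope, hr, hl, Finset.sum_add_distrib, neg_add]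
    ring
  | interior e t h0 h1 =>
    simp only [outgoingSlope, slopeRight_add hf hg e h0.le h1, slopeLeft_add hf hg e h0 h1.le]
    ring

end helpers

/-! ### Divisors, divisor classes, the Jacobian -/

/-- The divisor group: the free abelian group on the points of the metric graph. -/
abbrev Divisor : Type _ := G.Point ℓ →₀ ℤ

/-- The degree of a divisor. -/
def degree : G.Divisor ℓ →+ ℤ := Finsupp.liftAddHom fun _ => AddMonoidHom.id ℤ

/-- Principal divisors: the divisors of piecewise `ℤ`-linear functions `f`. The coefficient of
the divisor of `f` at a point `x` is minus the sum of the outgoing slopes of `f` at `x`. -/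
def principal [Fintype E] : AddSubgroup (G.Divisor ℓ) where
  carrier := {D | ∃ f, G.IsPLInt ℓ f ∧ ∀ x, (D x : ℝ) = -G.outgoingSlope ℓ f x}
  zero_mem' := ⟨fun _ => 0, IsPLInt.zero, fun x => by simp [outgoingSlope_zero]⟩
  add_mem' := by
    rintro D D' ⟨f, hf, hD⟩ ⟨g, hg, hD'⟩
    refine ⟨_, hf.add hg, fun x => ?_⟩
    rw [outgoingSlope_add hf hg, Finsupp.add_apply]
    push_cast
    rw [hD, hD']; ring
  neg_mem' := by
    rintro D ⟨f, hf, hD⟩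
    refine ⟨_, hf.neg, fun x => ?_⟩
    rw [outgoingSlope_neg, Finsupp.neg_apply]
    push_cast
    rw [hD]

/-- The Picard group: divisors modulo linear equivalence. -/
abbrev Pic [Fintype E] : Type _ := G.Divisor ℓ ⧸ G.principal ℓ

/-- The linear equivalence class of a divisor. -/
def divClass [Fintype E] (D : G.Divisor ℓ) : G.Pic ℓ := QuotientAddGroup.mk' (G.principal ℓ) D

/-- The Jacobian: the group of divisor classes of degree `0`. -/
def Jac [Fintype E] : AddSubgroup (G.Pic ℓ) :=
  (G.degree ℓ).ker.map (QuotientAddGroup.mk' (G.principal ℓ))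

/-- Effective divisors of degree `d`. -/
def IsEffective (d : ℕ) (D : G.Divisor ℓ) : Prop := (∀ x, 0 ≤ D x) ∧ G.degree ℓ D = d

/-- Effective divisor classes of degree `d`. -/
def Eff [Fintype E] (d : ℕ) : Set (G.Pic ℓ) := G.divClass ℓ '' {D | G.IsEffective ℓ d D}

variable {G ℓ} in
/-- The divisor `x₁ + ⋯ + x_d` of a tuple of points. -/
def sumPoints {d : ℕ} (x : Fin d → G.Point ℓ) : G.Divisor ℓ := ∑ i, Finsupp.single (x i) 1

lemma degree_sumPoints {d : ℕ} (x : Fin d → G.Point ℓ) : G.degree ℓ (sumPoints x) = d := by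
  simp [sumPoints, degree]

variable {G} in
/-- The divisor `v₁ + ⋯ + v_d` of the vertices of a cycle. -/
def Cycle.vertexSum {d : ℕ} (C : G.Cycle d) : G.Divisor ℓ :=
  sumPoints fun i => .vertex (C.vertex i)

variable {G} in
/-- The divisor `x₁ + ⋯ + x_d` of the midpoints of the edges of a cycle. -/
def Cycle.midpointSum {d : ℕ} (C : G.Cycle d) : G.Divisor ℓ :=
  sumPoints fun i => G.midpoint ℓ (C.edge i)

/-- The degree `d` Abel–Jacobi map `(x₁, …, x_d) ↦ [x₁ + ⋯ + x_d - D]`, where `D` has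
degree `d`. -/
def abelJacobi [Fintype E] {d : ℕ} (D : G.Divisor ℓ) (hD : G.degree ℓ D = d)
    (x : Fin d → G.Point ℓ) : G.Jac ℓ :=
  ⟨G.divClass ℓ (sumPoints x - D), sumPoints x - D,
    by simp [degree_sumPoints, hD], rfl⟩

/-- The degree `d` Manin–Mumford condition: for every effective divisor `D` of degree `d`, the image
of the Abel–Jacobi map with base divisor `D` contains only finitely many torsion points of the
Jacobian. (That image depends on `D` only through its class.) -/
def ManinMumford [Fintype E] (d : ℕ) : Prop :=
  ∀ (D : G.Divisor ℓ) (hD : G.IsEffective ℓ d D),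
    (range (G.abelJacobi ℓ D hD.2) ∩ (AddCommGroup.torsion (G.Jac ℓ) : Set (G.Jac ℓ))).Finite

/-- Torsion equivalence of effective divisor classes of degree `d`. -/
def TorsionEquivalent [Fintype E] (d : ℕ) (c c' : G.Pic ℓ) : Prop :=
  c ∈ G.Eff ℓ d ∧ c' ∈ G.Eff ℓ d ∧ ∃ n : ℕ, 0 < n ∧ n • (c - c') = 0

/-- The cell `Eff(e₁, …, e_k)`: the classes `[x₁ + ⋯ + x_k]` with `x_i` a point of the closed
edge `e_i`. -/
def cell [Fintype E] {k : ℕ} (e : Fin k → E) : Set (G.Pic ℓ) :=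
  {c | ∃ x : Fin k → G.Point ℓ,
    (∀ i, x i ∈ G.edgePoint ℓ (e i) '' Icc (0 : ℝ) (ℓ (e i))) ∧ c = G.divClass ℓ (sumPoints x)}

end OrientedGraph

end

/-! Orient the cycle and, for `n ≥ 2`, let `y_i` be the point of `e_i` at distance `ℓ(e_i)/n` from
`v_i`. The function that vanishes at all vertices and off the cycle, rises with slope `n - 1` from
`v_i` to `y_i` and falls with slope `1` to `v_{i+1}` has divisor `n(∑ y_i - ∑ v_i)`. So `[∑ y_i - ∑
v_i]` is killed by `n` (`nsmul_divPoint_sub_vertexSum_mem`).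

It is nonzero (`divPoint_sub_vertexSum_notMem`). If `f` had divisor `∑ y_i - ∑ v_i`, let `a_e` be
its slope on the part of `e` not between `v_i` and `y_i`. Then `a` is an integral conserved flow,
and `f(head e) - f(tail e) = a_e ℓ(e) ± ℓ(e)/n` on the cycle, without the correction elsewhere.
Pairing with `a` gives zero, while integrality bounds each term below by `a_e² ℓ(e)/2`. Hence `a =
0`, and `f` strictly increases all the way around the cycle, which is absurd.

The case `n = 2` gives the midpoints. Prime `n = p` gives classes of order exactly `p`, hence
infinitely many torsion points; in higher degree a fixed multiple of a vertex is added to both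
divisors. -/

noncomputable section

namespace OrientedGraph

variable {V E : Type*} {G : OrientedGraph V E} {ℓ : E → Ioi (0 : ℝ)} {d : ℕ}

/-! ### Edge parametrizations, one-sided slopes and affine segments -/

lemma edgePoint_of_nonpos (e : E) {t : ℝ} (h : t ≤ 0) :
    G.edgePoint ℓ e t = .vertex (G.tail e) := by
  simp [edgePoint, h]

lemma edgePoint_of_ge (e : E) {t : ℝ} (h : (ℓ e : ℝ) ≤ t) :
    G.edgePoint ℓ e t = .vertex (G.head e) := by
  have h0 : 0 < t := lt_of_lt_of_le (ℓ e).2 h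
  simp [edgePoint, h, h0.not_ge]

lemma edgePoint_of_mem (e : E) {t : ℝ} (h0 : 0 < t) (h1 : t < ℓ e) :
    G.edgePoint ℓ e t = .interior e t h0 h1 := by
  simp [edgePoint, h0.not_ge, h1.not_ge]

lemma continuous_edgePoint_Icc (e : E) :
    Continuous fun t : Icc (0 : ℝ) (ℓ e) => G.edgePoint ℓ e t :=
  continuous_iSup_rng continuous_coinduced_rng

lemma continuous_point_iff {f : G.Point ℓ → ℝ} :
    Continuous f ↔ ∀ e, ContinuousOn (fun t => f (G.edgePoint ℓ e t)) (Icc 0 (ℓ e)) := by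
  simp only [continuousOn_iff_continuous_domRestrict]
  constructor
  · exact fun h e => h.comp (continuous_edgePoint_Icc e)
  · exact fun h => continuous_iSup_dom.mpr fun e => continuous_coinduced_dom.mpr (h e)

lemma hasDerivWithinAt_Ici_of_affine {f : G.Point ℓ → ℝ} {e : E} {t b m : ℝ} (hb : t < b)
    (h : ∀ s ∈ Icc t b, f (G.edgePoint ℓ e s) = f (G.edgePoint ℓ e t) + m * (s - t)) :
    HasDerivWithinAt (fun s => f (G.edgePoint ℓ e s)) m (Ici t) t := by
  have hd : HasDerivWithinAt (fun s => f (G.edgePoint ℓ e t) + m * (s - t)) m (Icc t b) t := by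
    simpa using ((((hasDerivAt_id t).sub_const t).const_mul m).const_add
      (f (G.edgePoint ℓ e t))).hasDerivWithinAt (s := Icc t b)
  exact (hd.congr h (h t (left_mem_Icc.mpr hb.le))).mono_of_mem_nhdsWithin (Icc_mem_nhdsGE hb)

lemma hasDerivWithinAt_Iic_of_affine {f : G.Point ℓ → ℝ} {e : E} {t a m : ℝ} (ha : a < t)
    (h : ∀ s ∈ Icc a t, f (G.edgePoint ℓ e s) = f (G.edgePoint ℓ e a) + m * (s - a)) :
    HasDerivWithinAt (fun s => f (G.edgePoint ℓ e s)) m (Iic t) t := by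
  have hd : HasDerivWithinAt (fun s => f (G.edgePoint ℓ e a) + m * (s - a)) m (Icc a t) t := by
    simpa using ((((hasDerivAt_id t).sub_const a).const_mul m).const_add
      (f (G.edgePoint ℓ e a))).hasDerivWithinAt (s := Icc a t)
  exact (hd.congr h (h t (right_mem_Icc.mpr ha.le))).mono_of_mem_nhdsWithin (Icc_mem_nhdsLE ha)

lemma slopeRight_of_affine {f : G.Point ℓ → ℝ} {e : E} {t b m : ℝ} (hb : t < b)
    (h : ∀ s ∈ Icc t b, f (G.edgePoint ℓ e s) = f (G.edgePoint ℓ e t) + m * (s - t)) :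
    G.slopeRight ℓ f e t = m :=
  (hasDerivWithinAt_Ici_of_affine hb h).derivWithin (uniqueDiffOn_Ici t t self_mem_Ici)

lemma slopeLeft_of_affine {f : G.Point ℓ → ℝ} {e : E} {t a m : ℝ} (ha : a < t)
    (h : ∀ s ∈ Icc a t, f (G.edgePoint ℓ e s) = f (G.edgePoint ℓ e a) + m * (s - a)) :
    G.slopeLeft ℓ f e t = m :=
  (hasDerivWithinAt_Iic_of_affine ha h).derivWithin (uniqueDiffOn_Iic t t self_mem_Iic)

/-- At an interior point of an edge, the right slope is an integer. -/
lemma IsPLInt.exists_slopeRight {f : G.Point ℓ → ℝ} (hf : G.IsPLInt ℓ f) (e : E) {t : ℝ}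
    (h0 : 0 ≤ t) (h1 : t < ℓ e) : ∃ m : ℤ, G.slopeRight ℓ f e t = m := by
  obtain ⟨S, hS⟩ := hf.2 e
  obtain ⟨ε, hε, hgap⟩ := exists_gap S t
  have hb : t < min (t + ε) (ℓ e) := lt_min (by linarith) h1
  obtain ⟨m, hm⟩ := hS t (min (t + ε) (ℓ e)) h0 hb (min_le_right _ _)
    (fun s hs h => (hgap s hs).1 ⟨h.1, h.2.trans_le (min_le_left _ _)⟩)
  exact ⟨m, slopeRight_of_affine hb hm⟩

/-- A piecewise `ℤ`-linear function is affine on a segment of an edge if its divisor has no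
point in the interior of the segment. -/
lemma IsPLInt.exists_affine [Fintype E] {f : G.Point ℓ → ℝ} (hf : G.IsPLInt ℓ f) (e : E)
    {a b : ℝ} (h0 : 0 ≤ a) (hab : a < b) (h1 : b ≤ ℓ e)
    (h : ∀ (t : ℝ) (ht0 : 0 < t) (ht1 : t < ℓ e), a < t → t < b →
      G.outgoingSlope ℓ f (.interior e t ht0 ht1) = 0) :
    ∃ m : ℤ, ∀ t ∈ Icc a b, f (G.edgePoint ℓ e t) = f (G.edgePoint ℓ e a) + m * (t - a) := by
  set F : ℝ → ℝ := fun t => f (G.edgePoint ℓ e t) with hF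
  -- Off the support of the divisor the one-sided slopes agree, so `F` is differentiable there.
  have hderiv : ∀ t ∈ Ioo a b, HasDerivAt F (G.slopeRight ℓ f e t) t := by
    intro t ht
    have ht0 : 0 < t := h0.trans_lt ht.1
    have ht1 : t < ℓ e := ht.2.trans_le h1
    have hR := (hf.differentiableRight e ht0.le ht1).hasDerivWithinAt
    have hL := (hf.differentiableLeft e ht0 ht1.le).hasDerivWithinAt
    have heq := h t ht0 ht1 ht.1 ht.2
    simp only [outgoingSlope] at heq
    have : G.slopeLeft ℓ f e t = G.slopeRight ℓ f e t := by linarith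
    change HasDerivWithinAt F (G.slopeLeft ℓ f e t) (Iic t) t at hL
    rw [this] at hL
    simpa using hL.union hR
  have hint : ∀ t ∈ Ioo a b, ∃ m : ℤ, G.slopeRight ℓ f e t = m := fun t ht =>
    hf.exists_slopeRight e (h0.trans ht.1.le) (ht.2.trans_le h1)
  have hcont : ContinuousOn F (Icc a b) :=
    (continuous_point_iff.mp hf.1 e).mono (Icc_subset_Icc h0 h1)
  -- Darboux: the derivative has the intermediate value property. Being integer-valued, it is
  -- constant, with no induction over break points.
  have hord := (ordConnected_Ioo (a := a) (b := b)).image_hasDerivWithinAt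
    (fun t ht => (hderiv t ht).hasDerivWithinAt)
  have hc : (a + b) / 2 ∈ Ioo a b := ⟨by linarith, by linarith⟩
  obtain ⟨m, hm⟩ := hint _ hc
  have key : ∀ x ∈ Ioo a b, ∀ y ∈ Ioo a b, ∀ k l : ℤ, G.slopeRight ℓ f e x = k →
      G.slopeRight ℓ f e y = l → ¬ k < l := by
    intro x hx y hy k l hk hl hkl
    have hkl' : (k : ℝ) + 1 ≤ l := by exact_mod_cast hkl
    obtain ⟨z, hz, hz'⟩ := hord.out (mem_image_of_mem _ hx) (mem_image_of_mem _ hy)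
      (show (k : ℝ) + 1 / 2 ∈ _ from ⟨by rw [hk]; linarith, by rw [hl]; linarith⟩)
    obtain ⟨j, hj⟩ := hint z hz
    simp only [hj] at hz'
    have : (2 * j : ℝ) = 2 * k + 1 := by linarith
    have : 2 * j = 2 * k + 1 := by exact_mod_cast this
    omega
  have hconst : ∀ t ∈ Ioo a b, G.slopeRight ℓ f e t = m := by
    intro t ht
    obtain ⟨k, hk⟩ := hint t ht
    have h1 := key t ht _ hc k m hk hm
    have h2 := key _ hc t ht m k hm hk
    rw [hk, le_antisymm (not_lt.mp h2) (not_lt.mp h1)]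
  refine ⟨m, fun t ht => ?_⟩
  rcases ht.1.eq_or_lt with rfl | hat
  · simp
  obtain ⟨c, hc, hc'⟩ := exists_hasDerivAt_eq_slope F (G.slopeRight ℓ f e) hat
    (hcont.mono (Icc_subset_Icc_right ht.2)) fun x hx => hderiv x ⟨hx.1, hx.2.trans_le ht.2⟩
  rw [hconst c ⟨hc.1, hc.2.trans_le ht.2⟩, eq_div_iff (by linarith)] at hc'
  change F t = F a + _
  linarith

/-! ### Oriented cycles and the division points of their edges -/

open Classical in
lemma sumPoints_apply {k : ℕ} (x : Fin k → G.Point ℓ) (y : G.Point ℓ) :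
    sumPoints x y = ∑ i, if x i = y then 1 else 0 := by
  simp [sumPoints, Finsupp.finsetSum_apply, Finsupp.single_apply]

open Classical in
/-- The coefficient of an edge in the oriented cycle: `1` if the cycle traverses the edge from tail
to head, `-1` if it traverses it from head to tail, and `0` for the edges outside the cycle. -/
def Cycle.sign (C : G.Cycle d) (e : E) : ℤ :=
  if ∃ i, C.edge i = e ∧ G.tail e = C.vertex i ∧ G.head e = C.vertex (finRotate d i) then 1
  else if e ∈ range C.edge then -1 else 0

namespace Cycle

variable (C : G.Cycle d)

/-- A loop satisfies both alternatives of `endpoints`; testing the forward direction first gives it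
sign `1`, so it is counted once. -/
lemma sign_edge (i : Fin d) :
    (C.sign (C.edge i) = 1 ∧ G.tail (C.edge i) = C.vertex i ∧
      G.head (C.edge i) = C.vertex (finRotate d i)) ∨
    (C.sign (C.edge i) = -1 ∧ G.head (C.edge i) = C.vertex i ∧
      G.tail (C.edge i) = C.vertex (finRotate d i)) := by
  by_cases h : G.tail (C.edge i) = C.vertex i ∧ G.head (C.edge i) = C.vertex (finRotate d i)
  · exact Or.inl ⟨if_pos ⟨i, rfl, h⟩, h⟩
  · refine Or.inr ⟨?_, (C.endpoints i).resolve_left h⟩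
    have : ¬ ∃ j, C.edge j = C.edge i ∧ G.tail (C.edge i) = C.vertex j ∧
        G.head (C.edge i) = C.vertex (finRotate d j) := by
      rintro ⟨j, hj, hj'⟩
      rw [C.edge_injective hj] at hj'
      exact h hj'
    rw [sign, if_neg this, if_pos (mem_range_self i)]

lemma sign_of_notMem {e : E} (h : e ∉ range C.edge) : C.sign e = 0 := by
  have : ¬ ∃ i, C.edge i = e ∧ G.tail e = C.vertex i ∧ G.head e = C.vertex (finRotate d i) :=
    fun ⟨i, hi, _⟩ => h ⟨i, hi⟩
  rw [sign, if_neg this, if_neg h]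

lemma sign_cases (e : E) : C.sign e = 1 ∨ C.sign e = -1 ∨ C.sign e = 0 := by
  by_cases h : e ∈ range C.edge
  · obtain ⟨i, rfl⟩ := h
    rcases C.sign_edge i with h | h <;> simp [h.1]
  · simp [C.sign_of_notMem h]

lemma sign_edge_ne_zero (i : Fin d) : C.sign (C.edge i) ≠ 0 := by
  rcases C.sign_edge i with h | h <;> simp [h.1]

section counting

variable [Fintype E]

open Classical in
/-- Every vertex of the cycle is the starting point of exactly one oriented edge of the cycle. -/
lemma sum_start (v : V) :
    (∑ e with G.tail e = v, if C.sign e = 1 then (1 : ℝ) else 0) +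
      ∑ e with G.head e = v, (if C.sign e = -1 then (1 : ℝ) else 0) =
    ∑ i, if C.vertex i = v then (1 : ℝ) else 0 := by
  rw [Finset.sum_filter, Finset.sum_filter, ← Finset.sum_add_distrib]
  refine (Fintype.sum_of_injective C.edge C.edge_injective _ _ (fun e he => ?_) fun i => ?_).symm
  · simp [C.sign_of_notMem he]
  · rcases C.sign_edge i with h | h <;> simp [h.1, h.2.1]

open Classical in
/-- Every vertex of the cycle is the end point of exactly one oriented edge of the cycle. -/
lemma sum_finish (v : V) :
    (∑ e with G.head e = v, if C.sign e = 1 then (1 : ℝ) else 0) +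
      ∑ e with G.tail e = v, (if C.sign e = -1 then (1 : ℝ) else 0) =
    ∑ i, if C.vertex i = v then (1 : ℝ) else 0 := by
  -- Reindexing makes the `i`-th term refer to `v_{i+1}`, the end point of `e_i`.
  rw [← Equiv.sum_comp (finRotate d), Finset.sum_filter, Finset.sum_filter,
    ← Finset.sum_add_distrib]
  refine (Fintype.sum_of_injective C.edge C.edge_injective _ _ (fun e he => ?_) fun i => ?_).symm
  · simp [C.sign_of_notMem he]
  · rcases C.sign_edge i with h | h <;> simp [h.1, h.2.2]

end counting

variable (ℓ) in
/-- The parameter of the first of the points dividing an edge of the cycle into `n` equal parts,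
in the direction of the cycle. -/
def divParam (n : ℕ) (e : E) : ℝ := if C.sign e = 1 then ℓ e / n else ℓ e - ℓ e / n

/-- The bound `2 ≤ n` keeps the point off the vertices: `n = 1` would give `v_{i+1}`. -/
lemma divParam_mem {n : ℕ} (hn : 2 ≤ n) (e : E) : C.divParam ℓ n e ∈ Ioo (0 : ℝ) (ℓ e) := by
  have hl : (0 : ℝ) < ℓ e := (ℓ e).2
  have hn' : (2 : ℝ) ≤ n := by exact_mod_cast hn
  have h0 : (0 : ℝ) < ℓ e / n := by positivity
  have h1 : (ℓ e : ℝ) / n < ℓ e := div_lt_self hl (by linarith)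
  unfold divParam
  split_ifs <;> constructor <;> linarith

variable (ℓ) in
/-- The points at distance `ℓ(e_i) / n` from `v_i` on the edges `e_i` of the cycle. -/
def divPoint (n : ℕ) (i : Fin d) : G.Point ℓ :=
  G.edgePoint ℓ (C.edge i) (C.divParam ℓ n (C.edge i))

lemma divPoint_eq {n : ℕ} (hn : 2 ≤ n) (i : Fin d) :
    C.divPoint ℓ n i = .interior (C.edge i) (C.divParam ℓ n (C.edge i))
      (C.divParam_mem hn _).1 (C.divParam_mem hn _).2 :=
  edgePoint_of_mem _ _ _

lemma divPoint_two : C.divPoint ℓ 2 = fun i => G.midpoint ℓ (C.edge i) := by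
  funext i
  unfold divPoint midpoint
  congr 1
  unfold divParam
  split_ifs <;> push_cast <;> ring

lemma divPoint_mem {n : ℕ} (hn : 2 ≤ n) (i : Fin d) :
    C.divPoint ℓ n i ∈ G.edgePoint ℓ (C.edge i) '' Icc (0 : ℝ) (ℓ (C.edge i)) :=
  ⟨_, Ioo_subset_Icc_self (C.divParam_mem hn _), rfl⟩

lemma vertex_mem (i : Fin d) :
    (.vertex (C.vertex i) : G.Point ℓ) ∈
      G.edgePoint ℓ (C.edge i) '' Icc (0 : ℝ) (ℓ (C.edge i)) := by
  have hl : (0 : ℝ) ≤ ℓ (C.edge i) := (ℓ (C.edge i)).2.le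
  rcases C.endpoints i with h | h
  · exact ⟨0, left_mem_Icc.mpr hl, by rw [edgePoint_of_nonpos _ le_rfl, h.1]⟩
  · exact ⟨_, right_mem_Icc.mpr hl, by rw [edgePoint_of_ge _ le_rfl, h.1]⟩

open Classical in
lemma vertexSum_vertex (v : V) :
    ((C.vertexSum ℓ (.vertex v) : ℤ) : ℝ) = ∑ i, if C.vertex i = v then (1 : ℝ) else 0 := by
  simp [vertexSum, sumPoints_apply]

lemma vertexSum_interior (e : E) (t : ℝ) (h0 : 0 < t) (h1 : t < ℓ e) :
    C.vertexSum ℓ (.interior e t h0 h1) = 0 := by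
  simp [vertexSum, sumPoints_apply]

lemma divPoint_sum_vertex {n : ℕ} (hn : 2 ≤ n) (v : V) :
    sumPoints (C.divPoint ℓ n) (.vertex v) = 0 := by
  simp [sumPoints_apply, C.divPoint_eq hn]

open Classical in
lemma divPoint_sum_interior {n : ℕ} (hn : 2 ≤ n) (e : E) (t : ℝ) (h0 : 0 < t)
    (h1 : t < ℓ e) :
    sumPoints (C.divPoint ℓ n) (.interior e t h0 h1) =
      if C.sign e ≠ 0 ∧ C.divParam ℓ n e = t then 1 else 0 := by
  rw [sumPoints_apply]
  by_cases he : e ∈ range C.edge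
  · obtain ⟨j, rfl⟩ := he
    rw [Finset.sum_eq_single j]
    · simp [C.divPoint_eq hn, C.sign_edge_ne_zero j]
    · intro i _ hij
      have : C.edge i ≠ C.edge j := fun h => hij (C.edge_injective h)
      simp [C.divPoint_eq hn, this]
    · simp
  · have (i : Fin d) : C.edge i ≠ e := fun h => he ⟨i, h⟩
    simp [C.divPoint_eq hn, this, C.sign_of_notMem he]

end Cycle

/-! ### The torsion relation -/

/-- The function with zeros at the vertices that rises with slope `α e` on an edge `e` from the
tail and falls with slope `β e` towards the head. -/
def tent (α β : E → ℤ) : G.Point ℓ → ℝ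
  | .vertex _ => 0
  | .interior e t _ _ => min (α e * t) (β e * (ℓ e - t))

section tent

variable {α β : E → ℤ}

/-- Nonnegative slopes make the minimum vanish at both ends, in agreement with the value `0` at the
vertices. -/
lemma tent_edgePoint (hα : 0 ≤ α) (hβ : 0 ≤ β) (e : E) {t : ℝ} (h0 : 0 ≤ t) (h1 : t ≤ ℓ e) :
    tent α β (G.edgePoint ℓ e t) = min (α e * t) (β e * (ℓ e - t)) := by
  have ha : (0 : ℝ) ≤ α e := by exact_mod_cast hα e
  have hb : (0 : ℝ) ≤ β e := by exact_mod_cast hβ e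
  have hl : (0 : ℝ) < ℓ e := (ℓ e).2
  rcases h0.eq_or_lt with rfl | h0'
  · rw [edgePoint_of_nonpos _ le_rfl]
    simp [tent, mul_nonneg hb hl.le]
  rcases h1.eq_or_lt with rfl | h1'
  · rw [edgePoint_of_ge _ le_rfl]
    simp [tent, mul_nonneg ha hl.le]
  · rw [edgePoint_of_mem _ h0' h1']; rfl

variable {τ : E → ℝ} (hα : 0 ≤ α) (hβ : 0 ≤ β)
  (hτ : ∀ e, α e * τ e = β e * (ℓ e - τ e))

include hα hβ hτ

/-- The two lines meet at the apex `τ e`, and their difference is `(α e + β e)(τ e - t)`. If both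
slopes vanish, any `τ e` will do. -/
lemma tent_left (e : E) {t : ℝ} (h0 : 0 ≤ t) (h1 : t ≤ ℓ e) (h : t ≤ τ e) :
    tent α β (G.edgePoint ℓ e t) = α e * t := by
  have ha : (0 : ℝ) ≤ α e := by exact_mod_cast hα e
  have hb : (0 : ℝ) ≤ β e := by exact_mod_cast hβ e
  rw [tent_edgePoint hα hβ e h0 h1, min_eq_left]
  nlinarith [hτ e, mul_nonneg ha (sub_nonneg.mpr h), mul_nonneg hb (sub_nonneg.mpr h)]

lemma tent_right (e : E) {t : ℝ} (h0 : 0 ≤ t) (h1 : t ≤ ℓ e) (h : τ e ≤ t) :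
    tent α β (G.edgePoint ℓ e t) = β e * (ℓ e - t) := by
  have ha : (0 : ℝ) ≤ α e := by exact_mod_cast hα e
  have hb : (0 : ℝ) ≤ β e := by exact_mod_cast hβ e
  rw [tent_edgePoint hα hβ e h0 h1, min_eq_right]
  nlinarith [hτ e, mul_nonneg ha (sub_nonneg.mpr h), mul_nonneg hb (sub_nonneg.mpr h)]

lemma isPLInt_tent : G.IsPLInt ℓ (tent α β) := by
  refine ⟨continuous_point_iff.mpr fun e => ?_, fun e => ⟨{τ e}, fun a b h0 hab h1 hs => ?_⟩⟩
  · refine ContinuousOn.congr (f := fun t : ℝ => min (α e * t) (β e * (ℓ e - t))) (by fun_prop)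
      fun t ht => tent_edgePoint hα hβ e ht.1 ht.2
  · have hs' := hs _ (Finset.mem_singleton_self _)
    rcases le_or_gt b (τ e) with hb | hb
    · refine ⟨α e, fun t ht => ?_⟩
      rw [tent_left hα hβ hτ e (h0.trans ht.1) (ht.2.trans h1) (ht.2.trans hb),
        tent_left hα hβ hτ e h0 (hab.le.trans h1) (hab.le.trans hb)]
      ring
    · have ha : τ e ≤ a := not_lt.mp fun h => hs' ⟨h, hb⟩
      refine ⟨-β e, fun t ht => ?_⟩
      rw [tent_right hα hβ hτ e (h0.trans ht.1) (ht.2.trans h1) (ha.trans ht.1),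
        tent_right hα hβ hτ e h0 (hab.le.trans h1) ha]
      push_cast; ring

lemma slopeRight_tent_of_lt (e : E) {t : ℝ} (h0 : 0 ≤ t) (h1 : t < ℓ e) (h : t < τ e) :
    G.slopeRight ℓ (tent α β) e t = α e := by
  refine slopeRight_of_affine (lt_min h h1) fun s hs => ?_
  rw [tent_left hα hβ hτ e (h0.trans hs.1) (hs.2.trans (min_le_right _ _))
    (hs.2.trans (min_le_left _ _)), tent_left hα hβ hτ e h0 h1.le h.le]
  ring

lemma slopeRight_tent_of_ge (e : E) {t : ℝ} (h0 : 0 ≤ t) (h1 : t < ℓ e) (h : τ e ≤ t) :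
    G.slopeRight ℓ (tent α β) e t = -β e := by
  refine slopeRight_of_affine h1 fun s hs => ?_
  rw [tent_right hα hβ hτ e (h0.trans hs.1) hs.2 (h.trans hs.1),
    tent_right hα hβ hτ e h0 h1.le h]
  ring

lemma slopeLeft_tent_of_le (e : E) {t : ℝ} (h0 : 0 < t) (h1 : t ≤ ℓ e) (h : t ≤ τ e) :
    G.slopeLeft ℓ (tent α β) e t = α e := by
  refine slopeLeft_of_affine h0 fun s hs => ?_
  rw [tent_left hα hβ hτ e hs.1 (hs.2.trans h1) (hs.2.trans h),
    tent_left hα hβ hτ e le_rfl (ℓ e).2.le (h0.le.trans h)]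
  ring

lemma slopeLeft_tent_of_gt (e : E) {t : ℝ} (h0 : 0 < t) (h1 : t ≤ ℓ e) (h : τ e < t) :
    G.slopeLeft ℓ (tent α β) e t = -β e := by
  refine slopeLeft_of_affine (max_lt h h0) fun s hs => ?_
  rw [tent_right hα hβ hτ e ((le_max_right _ _).trans hs.1) (hs.2.trans h1)
    ((le_max_left _ _).trans hs.1),
    tent_right hα hβ hτ e (le_max_right _ _) ((max_lt h h0).le.trans h1) (le_max_left _ _)]
  ring

end tent

namespace Cycle

variable [Fintype E] (C : G.Cycle d)

/-- The points dividing the edges of the cycle in the ratio `1 : n - 1` differ from the vertices of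
the cycle by an `n`-torsion class. -/
theorem nsmul_divPoint_sub_vertexSum_mem {n : ℕ} (hn : 2 ≤ n) :
    n • (sumPoints (C.divPoint ℓ n) - C.vertexSum ℓ) ∈ G.principal ℓ := by
  classical
  have hn' : (2 : ℝ) ≤ n := by exact_mod_cast hn
  have hn0 : (n : ℝ) ≠ 0 := by positivity
  -- The slope is `n - 1` on the short piece next to `v_i` and `1` on the long one; the heights
  -- match since `(n - 1) · ℓ/n = ℓ - ℓ/n`.
  set α : E → ℤ := fun e => if C.sign e = 1 then n - 1 else if C.sign e = -1 then 1 else 0 with hαd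
  set β : E → ℤ := fun e => if C.sign e = -1 then n - 1 else if C.sign e = 1 then 1 else 0 with hβd
  have hα : 0 ≤ α := fun e => by
    simp only [hαd, Pi.zero_apply]; split_ifs <;> omega
  have hβ : 0 ≤ β := fun e => by
    simp only [hβd, Pi.zero_apply]; split_ifs <;> omega
  have hτ : ∀ e, α e * C.divParam ℓ n e = β e * (ℓ e - C.divParam ℓ n e) := fun e => by
    rcases C.sign_cases e with h | h | h
    · simp [hαd, hβd, divParam, h]; field_simp
    · simp [hαd, hβd, divParam, h]; field_simp
    · simp [hαd, hβd, h]
  refine ⟨tent α β, isPLInt_tent hα hβ hτ, fun x => ?_⟩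
  cases x with
  | vertex v =>
    have hr (e : E) : G.slopeRight ℓ (tent α β) e 0 =
        (n - 1) * (if C.sign e = 1 then 1 else 0) + if C.sign e = -1 then 1 else 0 := by
      rw [slopeRight_tent_of_lt hα hβ hτ e le_rfl (ℓ e).2 (C.divParam_mem hn e).1]
      rcases C.sign_cases e with h | h | h <;> simp [hαd, h]
    have hl (e : E) : -G.slopeLeft ℓ (tent α β) e (ℓ e) =
        (n - 1) * (if C.sign e = -1 then 1 else 0) + if C.sign e = 1 then 1 else 0 := by
      rw [slopeLeft_tent_of_gt hα hβ hτ e (ℓ e).2 le_rfl (C.divParam_mem hn e).2]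
      rcases C.sign_cases e with h | h | h <;> simp [hβd, h]
    have h1 := C.sum_start v
    have h2 := C.sum_finish v
    simp only [outgoingSlope, hr, hl, Finset.sum_add_distrib, ← Finset.mul_sum]
    rw [Finsupp.smul_apply, Finsupp.sub_apply, C.divPoint_sum_vertex hn]
    push_cast [nsmul_eq_mul]
    rw [C.vertexSum_vertex]
    -- A cycle vertex starts one edge (slope `n - 1`) and ends one (slope `1`), for a total of `n`.
    linear_combination (1 - (n : ℝ)) * -h1 + h2
  | interior e t h0 h1 =>
    rw [Finsupp.smul_apply, Finsupp.sub_apply, C.divPoint_sum_interior hn, C.vertexSum_interior]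
    simp only [outgoingSlope]
    rcases lt_trichotomy t (C.divParam ℓ n e) with h | h | h
    · rw [slopeRight_tent_of_lt hα hβ hτ e h0.le h1 h, slopeLeft_tent_of_le hα hβ hτ e h0 h1.le h.le]
      simp [h.ne']
    · rw [slopeRight_tent_of_ge hα hβ hτ e h0.le h1 h.ge,
        slopeLeft_tent_of_le hα hβ hτ e h0 h1.le h.le]
      rcases C.sign_cases e with hs | hs | hs <;> simp [hαd, hβd, h.symm, hs]
    · rw [slopeRight_tent_of_ge hα hβ hτ e h0.le h1 h.le,
        slopeLeft_tent_of_gt hα hβ hτ e h0 h1.le h]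
      simp [h.ne]

end Cycle

/-! ### Nontriviality of the torsion class -/

open Classical in
/-- A conserved flow is orthogonal to the coboundary of every function on the vertices. -/
lemma sum_flow_mul_coboundary [Finite V] [Fintype E] (a : E → ℝ) (φ : V → ℝ)
    (h : ∀ v, ∑ e with G.tail e = v, a e = ∑ e with G.head e = v, a e) :
    ∑ e, a e * (φ (G.head e) - φ (G.tail e)) = 0 := by
  have := Fintype.ofFinite V
  have key (p : E → V) : ∑ e, a e * φ (p e) = ∑ v, (∑ e with p e = v, a e) * φ v := by
    rw [← Finset.sum_fiberwise Finset.univ p]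
    refine Finset.sum_congr rfl fun v _ => ?_
    rw [Finset.sum_mul]
    refine Finset.sum_congr rfl fun e he => ?_
    rw [(Finset.mem_filter.mp he).2]
  simp only [mul_sub, Finset.sum_sub_distrib, key, h, sub_self]

namespace Cycle

variable [Fintype E] (C : G.Cycle d)

/-- The slopes, along a single edge, of a function with divisor `x₁ + ⋯ + x_d - v₁ - ⋯ - v_d`. -/
lemma exists_edge_slope {n : ℕ} (hn : 2 ≤ n) {f : G.Point ℓ → ℝ} (hf : G.IsPLInt ℓ f)
    (hD : ∀ x, (((sumPoints (C.divPoint ℓ n) - C.vertexSum ℓ) x : ℤ) : ℝ) =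
      -G.outgoingSlope ℓ f x) (e : E) :
    ∃ a : ℤ, G.slopeRight ℓ f e 0 = a + (if C.sign e = 1 then 1 else 0) ∧
      -G.slopeLeft ℓ f e (ℓ e) = -a + (if C.sign e = -1 then 1 else 0) ∧
      f (.vertex (G.head e)) - f (.vertex (G.tail e)) = a * ℓ e + C.sign e * (ℓ e / n) := by
  classical
  obtain ⟨hτ0, hτ1⟩ := C.divParam_mem (ℓ := ℓ) hn e
  have hD' (t : ℝ) (h0 : 0 < t) (h1 : t < ℓ e) : G.outgoingSlope ℓ f (.interior e t h0 h1) =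
      if C.sign e ≠ 0 ∧ C.divParam ℓ n e = t then -1 else 0 := by
    have := hD (.interior e t h0 h1)
    rw [Finsupp.sub_apply, C.divPoint_sum_interior hn, C.vertexSum_interior] at this
    split_ifs at this ⊢ <;> push_cast at this <;> linarith
  obtain ⟨p, hp⟩ := hf.exists_affine e le_rfl hτ0 hτ1.le fun t h0 h1 _ h => by
    simp [hD', h.ne']
  obtain ⟨q, hq⟩ := hf.exists_affine e hτ0.le hτ1 le_rfl fun t h0 h1 h _ => by
    simp [hD', h.ne]
  have hp0 := slopeRight_of_affine hτ0 hp
  have hq1 := slopeLeft_of_affine hτ1 hq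
  have hpq := hD' _ hτ0 hτ1
  simp only [outgoingSlope, slopeRight_of_affine hτ1 hq, slopeLeft_of_affine hτ0 hp,
    and_true] at hpq
  have h1 := hp _ (right_mem_Icc.mpr hτ0.le)
  have h2 := hq _ (right_mem_Icc.mpr hτ1.le)
  rw [edgePoint_of_nonpos e le_rfl] at h1
  rw [edgePoint_of_ge e le_rfl] at h2
  rw [hp0, hq1, h2, h1]
  -- `a` is the slope on the piece away from `v_i`: the second piece `q` if the edge is traversed
  -- forwards, the first piece `p` if backwards. The slope drops by `1` at the division point.
  rcases C.sign_cases e with h | h | h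
  · have hpq' : (p : ℝ) = q + 1 := by simp [h] at hpq; linarith
    exact ⟨q, by simp [h, hpq'], by simp [h], by simp [h, hpq', divParam]; ring⟩
  · have hpq' : (q : ℝ) = p - 1 := by simp [h] at hpq; linarith
    exact ⟨p, by simp [h], by simp [h, hpq']; ring, by simp [h, hpq', divParam]; ring⟩
  · have hpq' : (p : ℝ) = q := by simp [h] at hpq; linarith
    exact ⟨q, by simp [h, hpq'], by simp [h], by simp [h, hpq']; ring⟩

/-- The points dividing the edges of the cycle in the ratio `1 : n - 1` are not linearly equivalent
to the vertices of the cycle. -/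
theorem divPoint_sub_vertexSum_notMem [Finite V] {n : ℕ} (hn : 2 ≤ n) :
    sumPoints (C.divPoint ℓ n) - C.vertexSum ℓ ∉ G.principal ℓ := by
  classical
  rintro ⟨f, hf, hD⟩
  have hn' : (2 : ℝ) ≤ n := by exact_mod_cast hn
  choose a hr hl hfa using C.exists_edge_slope hn hf hD
  -- The extra outgoing slope `1` at the start of each cycle edge accounts exactly for the
  -- coefficient `-1` at `v_i`, so `a` alone is conserved.
  have hflow := sum_flow_mul_coboundary (G := G) (fun e => (a e : ℝ)) (fun v => f (.vertex v))
    fun v => by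
      have h := hD (.vertex v)
      rw [Finsupp.sub_apply, C.divPoint_sum_vertex hn] at h
      push_cast at h
      rw [C.vertexSum_vertex] at h
      simp only [outgoingSlope, hr, hl, Finset.sum_add_distrib, Finset.sum_neg_distrib] at h
      linarith [C.sum_start v]
  have hterm (e : E) : (a e : ℝ) ^ 2 * (ℓ e / 2) ≤
      a e * (f (.vertex (G.head e)) - f (.vertex (G.tail e))) := by
    have hle : (0 : ℝ) < ℓ e := (ℓ e).2
    have hdiv : (ℓ e : ℝ) / n ≤ ℓ e / 2 := by gcongr
    have hdiv0 : (0 : ℝ) ≤ ℓ e / n := by positivity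
    -- Integrality enters here: `|a| ≤ a²` for an integer `a`. With `ℓ/n ≤ ℓ/2` this leaves at least
    -- half of `a² ℓ`.
    have habs : -(a e : ℝ) ^ 2 ≤ a e * C.sign e := by
      have : -(a e) ^ 2 ≤ a e * C.sign e := by
        have h1 : 0 ≤ a e * (a e + 1) := by
          rcases le_or_gt 0 (a e) with h | h <;> nlinarith
        have h2 : 0 ≤ a e * (a e - 1) := by
          rcases le_or_gt (a e) 0 with h | h <;> nlinarith
        rcases C.sign_cases e with h | h | h <;> rw [h] <;> nlinarith
      exact_mod_cast this
    rw [hfa e]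
    nlinarith [mul_le_mul_of_nonneg_right habs hdiv0,
      mul_le_mul_of_nonneg_left hdiv (sq_nonneg (a e : ℝ))]
  have ha (e : E) : (a e : ℝ) = 0 := by
    have hpos (e : E) : 0 ≤ (a e : ℝ) ^ 2 * (ℓ e / 2) := by
      have hle : (0 : ℝ) < ℓ e := (ℓ e).2
      positivity
    have := (Finset.sum_eq_zero_iff_of_nonneg fun e _ => (hpos e).trans (hterm e)).mp hflow e
      (Finset.mem_univ e)
    have hle : (0 : ℝ) < ℓ e := (ℓ e).2
    have h0 : (a e : ℝ) ^ 2 * (ℓ e / 2) = 0 := le_antisymm ((hterm e).trans this.le) (hpos e)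
    simpa [hle.ne'] using h0
  have hstep (i : Fin d) : f (.vertex (C.vertex (finRotate d i))) - f (.vertex (C.vertex i)) =
      ℓ (C.edge i) / n := by
    have := hfa (C.edge i)
    rw [ha] at this
    rcases C.sign_edge i with ⟨h, h1, h2⟩ | ⟨h, h1, h2⟩ <;> rw [h, h1, h2] at this <;>
      push_cast at this <;> linarith
  -- The increments of `f` around the closed cycle cancel, yet each equals `ℓ(e_i)/n > 0`.
  have hsum : ∑ i, (f (.vertex (C.vertex (finRotate d i))) - f (.vertex (C.vertex i))) = 0 := by
    rw [Finset.sum_sub_distrib,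
      Equiv.sum_comp (finRotate d) fun i => f (.vertex (C.vertex i)), sub_self]
  have hpos : 0 < ∑ i : Fin d, (ℓ (C.edge i) : ℝ) / n :=
    Finset.sum_pos (fun i _ => div_pos (ℓ (C.edge i)).2 (by linarith)) ⟨⟨0, C.pos⟩, by simp⟩
  simp only [hstep] at hsum
  exact hpos.ne' hsum

end Cycle

/-! ### Divisor classes and failure of the Manin–Mumford condition -/

lemma divClass_eq_iff [Fintype E] {D D' : G.Divisor ℓ} :
    G.divClass ℓ D = G.divClass ℓ D' ↔ D - D' ∈ G.principal ℓ := by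
  rw [← sub_eq_zero, divClass, divClass, ← map_sub]
  exact QuotientAddGroup.eq_zero_iff _

lemma isEffective_sumPoints {k : ℕ} (x : Fin k → G.Point ℓ) :
    G.IsEffective ℓ k (sumPoints x) := by
  classical
  refine ⟨fun y => ?_, G.degree_sumPoints ℓ x⟩
  rw [sumPoints_apply]
  exact Finset.sum_nonneg fun i _ => by split_ifs <;> norm_num

lemma sumPoints_append {k m : ℕ} (x : Fin k → G.Point ℓ) (y : Fin m → G.Point ℓ) :
    sumPoints (Fin.append x y) = sumPoints x + sumPoints y := by
  simp [sumPoints, Fin.sum_univ_add]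

/-- A cycle obstructs the Manin–Mumford condition in all degrees at least its length. -/
theorem Cycle.not_maninMumford [Finite V] [Fintype E] (C : G.Cycle d) {k : ℕ} (hk : d ≤ k) :
    ¬ G.ManinMumford ℓ k := by
  obtain ⟨m, rfl⟩ := Nat.exists_eq_add_of_le hk
  intro hMM
  let v : Fin d → G.Point ℓ := fun i => .vertex (C.vertex i)
  -- Padding by `m` copies of one vertex, which cancels in the Abel–Jacobi difference.
  let w : Fin m → G.Point ℓ := fun _ => .vertex (C.vertex ⟨0, C.pos⟩)
  have hD := isEffective_sumPoints (Fin.append v w)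
  let z : Nat.Primes → G.Jac ℓ := fun p =>
    G.abelJacobi ℓ _ hD.2 (Fin.append (C.divPoint ℓ p) w)
  have hz (p : Nat.Primes) : ((z p : G.Jac ℓ) : G.Pic ℓ) =
      QuotientAddGroup.mk' (G.principal ℓ) (sumPoints (C.divPoint ℓ p) - C.vertexSum ℓ) := by
    change G.divClass ℓ _ = G.divClass ℓ _
    rw [sumPoints_append, sumPoints_append, add_sub_add_right_eq_sub]
    rfl
  have hsmul (p : Nat.Primes) : (p : ℕ) • z p = 0 := by
    apply Subtype.ext
    rw [AddSubgroup.coe_nsmul, hz, ← map_nsmul]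
    exact (QuotientAddGroup.eq_zero_iff _).mpr (C.nsmul_divPoint_sub_vertexSum_mem p.2.two_le)
  have hne (p : Nat.Primes) : z p ≠ 0 := fun h => by
    have h' := congrArg (Subtype.val) h
    rw [hz] at h'
    exact C.divPoint_sub_vertexSum_notMem p.2.two_le ((QuotientAddGroup.eq_zero_iff _).mp h')
  -- A nonzero class killed by a prime has that prime as its order, so different primes give
  -- different classes.
  have horder (p : Nat.Primes) : addOrderOf (z p) = p :=
    have : Fact (p : ℕ).Prime := ⟨p.2⟩
    addOrderOf_eq_prime (hsmul p) (hne p)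
  have hinj : Function.Injective z := fun p q h => by
    apply Subtype.ext
    rw [← horder p, ← horder q, h]
  refine Set.infinite_of_injective_forall_mem hinj (fun p => ?_) (hMM _ hD)
  refine ⟨mem_range_self _, ?_⟩
  exact isOfFinAddOrder_iff_nsmul_eq_zero.mpr ⟨p, p.2.pos, hsmul p⟩

lemma exists_cycle_of_girth_le {k : ℕ} (h : G.girth ≤ k) : ∃ d ≤ k, Nonempty (G.Cycle d) := by
  have hne : {n : ℕ∞ | ∃ d : ℕ, n = d ∧ Nonempty (G.Cycle d)}.Nonempty := by
    by_contra hempty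
    rw [girth, not_nonempty_iff_eq_empty.mp hempty, sInf_empty] at h
    exact ENat.natCast_ne_top k (top_le_iff.mp h)
  -- In the well-ordered `ℕ∞` the infimum of a nonempty set is attained, so some cycle realizes the
  -- girth.
  obtain ⟨d, hd, hC⟩ := csInf_mem hne
  exact ⟨d, by rw [girth, hd] at h; exact_mod_cast h, hC⟩

end OrientedGraph

end

theorem mainTheorem10 {V E : Type*} [Finite V] [Fintype E] (G : OrientedGraph V E)
    (hG : G.Connected) :
    -- a cycle with exactly `d` edges obstructs the Manin–Mumford condition in degree `d`
    (∀ d : ℕ, Nonempty (G.Cycle d) → ∀ ℓ : E → Set.Ioi (0 : ℝ), ¬ G.ManinMumford ℓ d) ∧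
    -- for every such cycle, the vertex sum and the sum of the midpoints of the edges have distinct,
    -- torsion equivalent classes, both in the cell of the edges of the cycle
    (∀ (d : ℕ) (C : G.Cycle d) (ℓ : E → Set.Ioi (0 : ℝ)),
      G.divClass ℓ (C.vertexSum ℓ) ≠ G.divClass ℓ (C.midpointSum ℓ) ∧
      G.TorsionEquivalent ℓ d (G.divClass ℓ (C.vertexSum ℓ)) (G.divClass ℓ (C.midpointSum ℓ)) ∧
      G.divClass ℓ (C.vertexSum ℓ) ∈ G.cell ℓ C.edge ∧
      G.divClass ℓ (C.midpointSum ℓ) ∈ G.cell ℓ C.edge) ∧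
    -- the condition fails in every degree at least the girth
    (∀ d : ℕ, G.girth ≤ d → ∀ ℓ : E → Set.Ioi (0 : ℝ), ¬ G.ManinMumford ℓ d) := by
  refine ⟨fun d ⟨C⟩ ℓ => C.not_maninMumford le_rfl, fun d C ℓ => ?_, fun d hd ℓ => ?_⟩
  · have hmid : C.midpointSum ℓ = OrientedGraph.sumPoints (C.divPoint ℓ 2) := by
      rw [C.divPoint_two]; rfl
    rw [hmid]
    refine ⟨fun h => C.divPoint_sub_vertexSum_notMem le_rfl
        (OrientedGraph.divClass_eq_iff.mp h.symm),
      ⟨⟨_, OrientedGraph.isEffective_sumPoints _, rfl⟩,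
        ⟨_, OrientedGraph.isEffective_sumPoints _, rfl⟩, 2, two_pos, ?_⟩,
      ⟨_, C.vertex_mem, rfl⟩, ⟨_, C.divPoint_mem le_rfl, rfl⟩⟩
    refine (QuotientAddGroup.eq_zero_iff (2 • (C.vertexSum ℓ -
      OrientedGraph.sumPoints (C.divPoint ℓ 2)))).mpr ?_
    rw [← neg_sub, smul_neg]
    exact neg_mem (C.nsmul_divPoint_sub_vertexSum_mem le_rfl)
  · obtain ⟨k, hk, ⟨C⟩⟩ := OrientedGraph.exists_cycle_of_girth_le hd
    exact C.not_maninMumford hk
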